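/- For integers $d, n \ge 1$, let $q_d^{(2)}(n)$ denote the number of partitions of $n$ into parts of size at least $2$ in which any two parts differ by at least $d$, and let $Q_d^{(2,-)}(n)$ denote the number of partitions of $n$ into parts congruent to $2$ or $-2$ modulo $d+3$, none of which is equal to $d+1$. Put $\Delta_d^{(2,2,-)}(n) = q_d^{(2)}(n) - Q_d^{(2,-)}(n)$. Then for every $d \ge 62$ and every $n \ge 1$, $$\Delta_d^{(2,2,-)}(n) \ge 0.$$ -/

import Mathlib

/-- `q_d^{(a)}(n)`: the number of partitions of `n` into parts of size at least `a` in which any two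
parts (at different positions of the non-increasing sequence of parts) differ by at least `d`. -/
def partsGapCount (d a n : ℕ) : ℕ :=
  (Finset.univ.filter fun p : n.Partition =>
    (∀ x ∈ p.parts, a ≤ x) ∧
      (p.parts.sort (fun x y => x ≥ y)).Pairwise fun x y => y + d ≤ x).card

/-- `Q_d^{(b,-)}(n)`: the number of partitions of `n` into parts congruent to `b` or `-b` modulo
`d + 3`, none of which is equal to `d + 3 - b` (for `1 ≤ b ≤ d + 2`). -/
def partsModCountMinus (d b n : ℕ) : ℕ :=
  (Finset.univ.filter fun p : n.Partition =>
    ∀ x ∈ p.parts,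
      ((x : ℤ) ≡ (b : ℤ) [ZMOD ((d : ℤ) + 3)] ∨ (x : ℤ) ≡ -(b : ℤ) [ZMOD ((d : ℤ) + 3)]) ∧
        (x : ℤ) ≠ (d : ℤ) + 3 - (b : ℤ)).card

/-- `Δ_d^{(a,b,-)}(n) = q_d^{(a)}(n) - Q_d^{(b,-)}(n)`, as an integer. -/
def deltaMinus (d a b n : ℕ) : ℤ :=
  (partsGapCount d a n : ℤ) - (partsModCountMinus d b n : ℤ)

/-! Put M = n / (d + 2), rounded down. A part counted by `partsModCountMinus` other than 2 is
w(d+3)+2 with w ≥ 1 or w(d+3)-2 with w ≥ 2, hence at least w(d+2). The total n fixes the number of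
twos, so these partitions inject into multiplicity vectors of weighted sum at most M, a number that
does not involve d.

On the gap side, partitions into k parts already suffice. Beyond the minimal configuration 2, 2+d,
2+2d, ... there remains an excess of at least d(M - C(k,2)), and distributing it counts lattice
points of a simplex. The volume gives at least (d(M - C(k,2)))^(k-1) / (k! (k-1)!) partitions, which
grows with d, so d = 62 is the worst case.

Take k = max(2, ⌊√M⌋). For 2 ≤ M ≤ 48 the inequality is a finite table. For M ≥ 49 a saddle-point
estimate of the generating function bounds the weighted count by 40^(k+1)
(`boundedCount_pairWeights_le`), which `forty_pow_mul_factorial_le` compares with the volume. For M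
≤ 1 explicit partitions are enough. -/

/-! ### Weighted counts and their tabulation -/

/-- The number of `f` with values in `ℕ` indexed by the list `ws` such that `∑ w * f w ≤ M`. -/
def boundedCount : List ℕ → ℕ → ℕ
  | [], _ => 1
  | w :: ws, M => ∑ i ∈ Finset.range (M / w + 1), boundedCount ws (M - i * w)

theorem boundedCount_cons_of_lt {w M : ℕ} (ws : List ℕ) (h : M < w) :
    boundedCount (w :: ws) M = boundedCount ws M := by
  simp [boundedCount, Nat.div_eq_of_lt h]

theorem boundedCount_cons_of_le {w M : ℕ} (ws : List ℕ) (hw : 0 < w) (h : w ≤ M) :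
    boundedCount (w :: ws) M = boundedCount ws M + boundedCount (w :: ws) (M - w) := by
  have h1 : M / w = (M - w) / w + 1 := by
    rw [← Nat.add_div_right _ hw, Nat.sub_add_cancel h]
  rw [boundedCount, boundedCount, h1, Finset.sum_range_succ', add_comm]
  congr 1
  · simp
  · refine Finset.sum_congr rfl fun i _ => ?_
    congr 1
    rw [Nat.sub_sub]
    congr 1
    ring

/-- Multiplication of a reversed table of values by `1 / (1 - z ^ w)`. -/
def tableStep (w : ℕ) (l : List ℕ) : List ℕ :=
  l.foldr (fun a r => (a + r.getD (w - 1) 0) :: r) []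

theorem tableStep_map_boundedCount {w : ℕ} (hw : 0 < w) (ws : List ℕ) (N : ℕ) :
    tableStep w ((List.range N).reverse.map (boundedCount ws)) =
      (List.range N).reverse.map (boundedCount (w :: ws)) := by
  induction N with
  | zero => rfl
  | succ N ih =>
    rw [List.range_succ, List.reverse_append, List.reverse_singleton, List.singleton_append,
      List.map_cons, List.map_cons]
    change (_ + (tableStep w _).getD _ _) :: tableStep w _ = _
    rw [ih]
    congr 1
    rcases lt_or_ge N w with h | h
    -- The index `w - 1` runs off the table, and the default `0` stands for the missing term.
    · rw [boundedCount_cons_of_lt ws h, List.getD_eq_default, add_zero]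
      simp; omega
    · rw [boundedCount_cons_of_le ws hw h, List.getD_eq_getElem _ _ (by simp; omega)]
      congr 2
      simp
      congr 1
      omega

/-- The reversed table of the first `N` values of `boundedCount ws`. -/
def countTable (N : ℕ) (ws : List ℕ) : List ℕ :=
  ws.foldr tableStep (List.replicate N 1)

theorem countTable_eq {N : ℕ} {ws : List ℕ} (h : ∀ w ∈ ws, 0 < w) :
    countTable N ws = (List.range N).reverse.map (boundedCount ws) := by
  induction ws with
  | nil =>
    simp only [countTable, List.foldr_nil]
    symm
    rw [List.eq_replicate_iff]
    simp [boundedCount]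
  | cons w ws ih =>
    rw [← tableStep_map_boundedCount (h w (by simp)), ← ih fun v hv => h v (by simp [hv])]
    rfl

/-- The two ranges are the weights of w(d+3)+2 and of w(d+3)-2; the second starts at 2 because d+1
is forbidden. -/
def pairWeights (m : ℕ) : List ℕ := List.range' 1 m ++ List.range' 2 (m - 1)

/-- Weights above M do not affect the count at M, so one table with weights up to 48 serves every M.
It is reversed: the value at M has index 48 - M. -/
theorem table_check : ∀ M ∈ Finset.Icc 2 48,
    (countTable 49 (pairWeights 48)).getD (48 - M) 0 *
      ((max 2 M.sqrt).factorial * (max 2 M.sqrt - 1).factorial) ≤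
      (62 * (M - (max 2 M.sqrt).choose 2)) ^ (max 2 M.sqrt - 1) := by
  decide +kernel

theorem pos_of_mem_pairWeights {m w : ℕ} (h : w ∈ pairWeights m) : 0 < w := by
  simp [pairWeights] at h; omega

theorem boundedCount_small {M : ℕ} (h2 : 2 ≤ M) (h48 : M ≤ 48) :
    boundedCount (pairWeights 48) M *
      ((max 2 M.sqrt).factorial * (max 2 M.sqrt - 1).factorial) ≤
      (62 * (M - (max 2 M.sqrt).choose 2)) ^ (max 2 M.sqrt - 1) := by
  have h := table_check M (by simp [h2, h48])
  rw [countTable_eq fun w hw => pos_of_mem_pairWeights hw,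
    List.getD_eq_getElem _ _ (by simp; omega)] at h
  have e : 49 - 1 - (48 - M) = M := by omega
  simpa [e] using h

/-! ### Injecting a family into multiplicity vectors -/

/-- A family whose members are determined by finitely many counts of bounded weighted sum. -/
theorem card_le_boundedCount {α : Type*} [DecidableEq α] (L : List ((α → ℕ) × ℕ))
    (hpos : ∀ q ∈ L, 0 < q.2) (A : Finset α) (M : ℕ)
    (hsum : ∀ p ∈ A, (L.map fun q => q.2 * q.1 p).sum ≤ M)
    (hinj : ∀ p ∈ A, ∀ p' ∈ A, (∀ q ∈ L, q.1 p = q.1 p') → p = p') :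
    A.card ≤ boundedCount (L.map Prod.snd) M := by
  induction L generalizing A M with
  | nil =>
    simp only [List.map_nil, boundedCount]
    exact Finset.card_le_one.2 fun p hp p' hp' => hinj p hp p' hp' (by simp)
  | cons q L ih =>
    obtain ⟨c, w⟩ := q
    have hw : 0 < w := hpos (c, w) (by simp)
    have hle : ∀ p ∈ A, c p * w ≤ M := fun p hp => by
      have := hsum p hp
      simp only [List.map_cons, List.sum_cons] at this
      rw [mul_comm]; omega
    have hmaps : ∀ p ∈ A, c p ∈ Finset.range (M / w + 1) := fun p hp => by
      rw [Finset.mem_range, Nat.lt_succ_iff, Nat.le_div_iff_mul_le hw]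
      exact hle p hp
    rw [Finset.card_eq_sum_card_fiberwise hmaps, List.map_cons, boundedCount]
    refine Finset.sum_le_sum fun i _ => ih (fun q hq => hpos q (by simp [hq])) _ _ ?_ ?_
    · intro p hp
      rw [Finset.mem_filter] at hp
      have h1 := hsum p hp.1
      simp only [List.map_cons, List.sum_cons, hp.2] at h1
      rw [mul_comm i]
      dsimp only at h1 ⊢
      omega
    · intro p hp p' hp' h
      rw [Finset.mem_filter] at hp hp'
      refine hinj p hp.1 p' hp'.1 fun q hq => ?_
      rcases List.mem_cons.1 hq with rfl | hq
      · simp [hp.2, hp'.2]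
      · exact h q hq

/-! ### Lower bound: simplex volume and gap partitions -/

theorem pow_succ_le_add_mul_pow (j c Y : ℕ) :
    (Y + c) ^ (j + 1) ≤ Y ^ (j + 1) + c * (j + 1) * (Y + c) ^ j := by
  induction j with
  | zero => simp
  | succ j ih =>
    calc (Y + c) ^ (j + 1 + 1) = (Y + c) ^ (j + 1) * Y + c * (Y + c) ^ (j + 1) := by ring
      _ ≤ (Y ^ (j + 1) + c * (j + 1) * (Y + c) ^ j) * Y + c * (Y + c) ^ (j + 1) := by gcongr
      _ ≤ (Y ^ (j + 1) * Y + c * (j + 1) * ((Y + c) ^ j * (Y + c))) + c * (Y + c) ^ (j + 1) := by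
        rw [add_mul, mul_assoc (c * (j + 1))]
        gcongr
        omega
      _ = _ := by ring

/-- Lattice points dominate the volume of the simplex. -/
theorem pow_length_le_boundedCount (ws : List ℕ) (hpos : ∀ w ∈ ws, 0 < w) (X : ℕ) :
    X ^ ws.length ≤ boundedCount ws X * (ws.length.factorial * ws.prod) := by
  induction ws generalizing X with
  | nil => simp [boundedCount]
  | cons w ws ih =>
    have hw : 0 < w := hpos w (by simp)
    have ih := ih fun v hv => hpos v (by simp [hv])
    have key : ∀ Z, w * (ws.length + 1) * Z ^ ws.length ≤
        boundedCount ws Z * ((ws.length + 1).factorial * (w * ws.prod)) := fun Z => by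
      calc _ ≤ w * (ws.length + 1) * (boundedCount ws Z * (ws.length.factorial * ws.prod)) := by
            gcongr; exact ih Z
        _ = _ := by rw [Nat.factorial_succ]; ring
    rw [List.length_cons, List.prod_cons]
    induction X using Nat.strong_induction_on with
    | _ X ihX =>
    rcases lt_or_ge X w with h | h
    · rw [boundedCount_cons_of_lt ws h]
      refine le_trans ?_ (key X)
      rw [pow_succ, mul_comm]
      gcongr
      nlinarith
    -- The count at X splits into its value at X - w and the count without w; the two induction
    -- hypotheses add up to X^(j+1) by the power inequality.
    · rw [boundedCount_cons_of_le ws hw h, add_mul]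
      have h1 := ihX (X - w) (by omega)
      have h2 := pow_succ_le_add_mul_pow ws.length w (X - w)
      rw [Nat.sub_add_cancel h] at h2
      have := key X
      omega

/-- The list `[j + 1, j, …, 2]`. -/
def descList : ℕ → List ℕ
  | 0 => []
  | j + 1 => (j + 2) :: descList j

theorem descList_length (j : ℕ) : (descList j).length = j := by
  induction j with
  | zero => rfl
  | succ j ih => simp [descList, ih]

theorem descList_prod (j : ℕ) : (descList j).prod = (j + 1).factorial := by
  induction j with
  | zero => rfl
  | succ j ih => rw [descList, List.prod_cons, ih, Nat.factorial_succ (j + 1)]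

theorem pos_of_mem_descList {j w : ℕ} (h : w ∈ descList j) : 0 < w := by
  induction j with
  | zero => simp [descList] at h
  | succ j ih =>
    rcases List.mem_cons.1 h with rfl | h
    · omega
    · exact ih h

/-- Lists with `j + 1` entries at least `a`, gaps at least `d` and prescribed sum. -/
theorem exists_gapLists (d j a X : ℕ) : ∃ F : Finset (List ℕ),
    boundedCount (descList j) X ≤ F.card ∧ ∀ l ∈ F, l.Pairwise (fun x y => x + d ≤ y) ∧
      (∀ x ∈ l, a ≤ x) ∧ l.sum = (j + 1) * a + d * (j + 1).choose 2 + X := by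
  induction j generalizing a X with
  -- A single part absorbs all the excess, so there is no coordinate of weight 1.
  | zero => exact ⟨{[a + X]}, by simp [descList, boundedCount], by simp⟩
  | succ j ih =>
    choose F hF hF' using ih
    -- Raising the smallest part by i raises all j + 2 parts, at a cost of i(j + 2).
    refine ⟨(Finset.range (X / (j + 2) + 1)).biUnion fun i =>
      (F (a + i + d) (X - i * (j + 2))).image (List.cons (a + i)), ?_, ?_⟩
    · rw [Finset.card_biUnion]
      · rw [descList, boundedCount]
        refine Finset.sum_le_sum fun i _ => ?_
        rw [Finset.card_image_of_injective _ (List.cons_injective)]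
        exact hF _ _
      · intro i _ i' _ hne
        rw [Function.onFun, Finset.disjoint_left]
        intro l hl hl'
        simp only [Finset.mem_image] at hl hl'
        obtain ⟨t, _, rfl⟩ := hl
        obtain ⟨t', _, h⟩ := hl'
        simp only [List.cons.injEq] at h
        omega
    · intro l hl
      simp only [Finset.mem_biUnion, Finset.mem_range, Finset.mem_image] at hl
      obtain ⟨i, hi, t, ht, rfl⟩ := hl
      obtain ⟨h1, h2, h3⟩ := hF' _ _ t ht
      refine ⟨List.pairwise_cons.2 ⟨fun y hy => h2 y hy, h1⟩, ?_, ?_⟩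
      · intro x hx
        rcases List.mem_cons.1 hx with rfl | hx
        · omega
        · have := h2 x hx; omega
      · have hX : i * (j + 2) ≤ X := by
          rw [← Nat.le_div_iff_mul_le (by omega)]; omega
        obtain ⟨Y, rfl⟩ := Nat.exists_eq_add_of_le hX
        rw [List.sum_cons, h3, Nat.choose_succ_succ' (j + 1) 1, Nat.choose_one_right,
          Nat.add_sub_cancel_left]
        ring

theorem card_le_partsGapCount (d a n : ℕ) (ha : 0 < a) (F : Finset (List ℕ))
    (hF : ∀ l ∈ F, l.Pairwise (fun x y => x + d ≤ y) ∧ (∀ x ∈ l, a ≤ x) ∧ l.sum = n) :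
    F.card ≤ partsGapCount d a n := by
  classical
  refine Finset.card_le_card_of_surjOn
    (fun p : n.Partition => (p.parts.sort (fun x y => x ≥ y)).reverse) ?_
  intro l hl
  obtain ⟨h1, h2, h3⟩ := hF l hl
  have hsort : (l : Multiset ℕ).sort (fun x y => x ≥ y) = l.reverse := by
    refine List.Perm.eq_of_pairwise (le := fun x y => x ≥ y) ?_ ?_ ?_ ?_
    · intro x y _ _ h h'; exact le_antisymm h' h
    · exact Multiset.pairwise_sort _ _
    · rw [List.pairwise_reverse]
      exact h1.imp fun h => by omega
    · rw [← Multiset.coe_eq_coe, Multiset.sort_eq, Multiset.coe_reverse]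
  refine ⟨⟨l, fun hx => lt_of_lt_of_le ha (h2 _ (by simpa using hx)), by simpa using h3⟩, ?_, ?_⟩
  · simp only [Finset.coe_filter, Finset.mem_univ, true_and, Set.mem_ofPred_eq]
    refine ⟨fun x hx => h2 x (by simpa using hx), ?_⟩
    rw [hsort, List.pairwise_reverse]
    exact h1
  · simp only [hsort, List.reverse_reverse]

theorem boundedCount_le_partsGapCount (d a n j X : ℕ) (ha : 0 < a)
    (h : (j + 1) * a + d * (j + 1).choose 2 + X = n) :
    boundedCount (descList j) X ≤ partsGapCount d a n := by
  obtain ⟨F, hF, hF'⟩ := exists_gapLists d j a X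
  exact hF.trans (card_le_partsGapCount d a n ha F fun l hl => h ▸ hF' l hl)

/-! ### Upper bound: generating function and factorial estimates -/

/-- Expand the logarithms and sum over i first: with x = K/(K+1), Bernoulli gives x^j/(1-x^j) ≤ K/j,
so the j-th term is at most K/j², and ζ(2) = π²/6. -/
theorem sum_neg_log_one_sub_pow_le {K : ℝ} (hK : 0 < K) (m : ℕ) :
    ∑ i ∈ Finset.range m, -Real.log (1 - (K / (K + 1)) ^ (i + 1)) ≤ K * (Real.pi ^ 2 / 6) := by
  set x : ℝ := K / (K + 1) with hx
  have hx0 : 0 < x := by positivity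
  have hx1 : x < 1 := by rw [hx, div_lt_one (by positivity)]; linarith
  have hlog : HasSum (fun j : ℕ => ∑ i ∈ Finset.range m, (x ^ (i + 1)) ^ (j + 1) / ((j : ℝ) + 1))
      (∑ i ∈ Finset.range m, -Real.log (1 - x ^ (i + 1))) := by
    refine hasSum_sum fun i _ => Real.hasSum_pow_div_log_of_abs_lt_one ?_
    rw [abs_of_pos (by positivity)]
    exact pow_lt_one₀ hx0.le hx1 (by omega)
  have hz : HasSum (fun j : ℕ => K * (1 / ((j + 1 : ℕ) : ℝ) ^ 2)) (K * (Real.pi ^ 2 / 6)) := by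
    have := (hasSum_nat_add_iff' 1).2 hasSum_zeta_two
    simpa using this.mul_left K
  refine hasSum_le (fun j => ?_) hlog hz
  have hy1 : x ^ (j + 1) < 1 := pow_lt_one₀ hx0.le hx1 (by omega)
  have hy0 : 0 < x ^ (j + 1) := by positivity
  have hbern : 1 + ((j + 1 : ℕ) : ℝ) * (1 / K) ≤ (1 + 1 / K) ^ (j + 1) :=
    one_add_mul_le_pow (by have : 0 < 1 / K := by positivity
                           linarith) _
  have hinv : (1 + 1 / K) ^ (j + 1) * x ^ (j + 1) = 1 := by
    rw [← mul_pow, hx]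
    have : (1 + 1 / K) * (K / (K + 1)) = 1 := by field_simp
    rw [this, one_pow]
  have hgeom : ∑ i ∈ Finset.range m, (x ^ (i + 1)) ^ (j + 1) ≤ K / ((j + 1 : ℕ) : ℝ) := by
    have h1 : ∑ i ∈ Finset.range m, (x ^ (i + 1)) ^ (j + 1) =
        x ^ (j + 1) * ∑ i ∈ Finset.range m, (x ^ (j + 1)) ^ i := by
      rw [Finset.mul_sum]
      refine Finset.sum_congr rfl fun i _ => ?_
      ring
    have h2 : (1 - x ^ (j + 1)) * ∑ i ∈ Finset.range m, (x ^ (j + 1)) ^ i ≤ 1 := by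
      rw [mul_neg_geom_sum]
      have : 0 < (x ^ (j + 1)) ^ m := by positivity
      linarith
    rw [h1, le_div_iff₀ (by positivity)]
    have h3 : ((j + 1 : ℕ) : ℝ) * x ^ (j + 1) ≤ K * (1 - x ^ (j + 1)) := by
      have := mul_le_mul_of_nonneg_right hbern hy0.le
      rw [hinv] at this
      have h4 : ((j + 1 : ℕ) : ℝ) * (1 / K) * x ^ (j + 1) ≤ 1 - x ^ (j + 1) := by linarith
      calc ((j + 1 : ℕ) : ℝ) * x ^ (j + 1)
          = K * (((j + 1 : ℕ) : ℝ) * (1 / K) * x ^ (j + 1)) := by field_simp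
        _ ≤ _ := by gcongr
    have hS : 0 ≤ ∑ i ∈ Finset.range m, (x ^ (j + 1)) ^ i := by positivity
    calc _ = (((j + 1 : ℕ) : ℝ) * x ^ (j + 1)) * ∑ i ∈ Finset.range m, (x ^ (j + 1)) ^ i := by ring
      _ ≤ (K * (1 - x ^ (j + 1))) * ∑ i ∈ Finset.range m, (x ^ (j + 1)) ^ i := by gcongr
      _ = K * ((1 - x ^ (j + 1)) * ∑ i ∈ Finset.range m, (x ^ (j + 1)) ^ i) := by ring
      _ ≤ K * 1 := by gcongr
      _ = K := mul_one K
  rw [← Finset.sum_div, div_le_iff₀ (by positivity)]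
  refine hgeom.trans (le_of_eq ?_)
  push_cast
  field_simp

/-- Rankin's trick: each vector of weighted sum at most M contributes at least x^M to the generating
function at x. -/
theorem boundedCount_le_mul_prod {x : ℝ} (hx0 : 0 < x) (hx1 : x < 1) (ws : List ℕ)
    (hpos : ∀ w ∈ ws, 0 < w) (M : ℕ) :
    (boundedCount ws M : ℝ) * x ^ M ≤ (ws.map fun w => (1 - x ^ w)⁻¹).prod := by
  induction ws generalizing M with
  | nil => simpa [boundedCount] using pow_le_one₀ hx0.le hx1.le
  | cons w ws ih =>
    have hw : 0 < w := hpos w (by simp)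
    have ih := ih fun v hv => hpos v (by simp [hv])
    have hxw : x ^ w < 1 := pow_lt_one₀ hx0.le hx1 hw.ne'
    have hP : 0 ≤ (ws.map fun w => (1 - x ^ w)⁻¹).prod :=
      le_trans (by positivity) (ih 0)
    rw [List.map_cons, List.prod_cons, boundedCount, Nat.cast_sum, Finset.sum_mul]
    calc _ ≤ ∑ i ∈ Finset.range (M / w + 1), (x ^ w) ^ i *
          (ws.map fun w => (1 - x ^ w)⁻¹).prod := by
          refine Finset.sum_le_sum fun i hi => ?_
          have hM : i * w ≤ M := by
            rw [← Nat.le_div_iff_mul_le hw]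
            exact Nat.lt_succ_iff.1 (Finset.mem_range.1 hi)
          calc _ = (x ^ w) ^ i * (boundedCount ws (M - i * w) * x ^ (M - i * w)) := by
                rw [← pow_mul, mul_left_comm, ← pow_add, mul_comm w, Nat.add_sub_cancel' hM]
            _ ≤ _ := by gcongr; exact ih _
      _ = (∑ i ∈ Finset.range (M / w + 1), (x ^ w) ^ i) *
          (ws.map fun w => (1 - x ^ w)⁻¹).prod := by rw [Finset.sum_mul]
      _ ≤ _ := by
        gcongr
        rw [← one_div, le_div_iff₀ (by linarith), geom_sum_mul_neg]
        have : 0 < (x ^ w) ^ (M / w + 1) := by positivity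
        linarith

theorem prod_range'_le {K : ℝ} (hK : 0 < K) (m : ℕ) :
    ((List.range' 1 m).map fun w => (1 - (K / (K + 1)) ^ w)⁻¹).prod ≤
      Real.exp (K * (Real.pi ^ 2 / 6)) := by
  have hx0 : 0 < K / (K + 1) := by positivity
  have hx1 : K / (K + 1) < 1 := by rw [div_lt_one (by positivity)]; linarith
  refine le_trans (le_of_eq ?_) (Real.exp_le_exp.2 (sum_neg_log_one_sub_pow_le hK m))
  rw [Real.exp_sum, List.range'_eq_map_range, List.map_map, ← List.toFinset_range,
    List.prod_toFinset _ List.nodup_range]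
  congr 2
  funext i
  have : 0 < 1 - (K / (K + 1)) ^ (i + 1) := sub_pos.2 (pow_lt_one₀ hx0.le hx1 (by omega))
  rw [Real.exp_neg, Real.exp_log this, Function.comp_apply, add_comm 1 i]

theorem exp_growth_le : Real.exp (2 + Real.pi ^ 2 / 6) ≤ 40 := by
  have hpi : Real.pi ^ 2 / 6 ≤ 33 / 20 := by
    nlinarith [Real.pi_lt_d4, Real.pi_pos]
  have h1 : Real.exp (73 / 20) ^ 20 ≤ 40 ^ 20 := by
    rw [← Real.exp_nat_mul]
    have : ((20 : ℕ) : ℝ) * (73 / 20) = ((73 : ℕ) : ℝ) * 1 := by norm_num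
    rw [this, Real.exp_nat_mul]
    calc _ ≤ (2.7182818286 : ℝ) ^ 73 := by gcongr; exact Real.exp_one_lt_d9.le
      _ ≤ _ := by norm_num
  refine le_trans (Real.exp_le_exp.2 (by linarith)) (le_of_pow_le_pow_left₀ (n := 20) (by norm_num) (by norm_num) h1)

theorem pow_add_mul_pow_le_add_pow (Y c i : ℕ) :
    Y ^ (i + 1) + (i + 1) * c * Y ^ i ≤ (Y + c) ^ (i + 1) := by
  induction i with
  | zero => simp
  | succ i ih =>
    calc _ ≤ (Y ^ (i + 1) + (i + 1) * c * Y ^ i) * (Y + c) := by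
          have : 0 ≤ (i + 1) * c * Y ^ i * c := Nat.zero_le _
          ring_nf at this ⊢
          omega
      _ ≤ (Y + c) ^ (i + 1) * (Y + c) := by gcongr
      _ = _ := by ring

theorem forty_pow_mul_factorial_le {k : ℕ} (hk : 7 ≤ k) :
    40 ^ (k + 1) * (k.factorial * (k - 1).factorial) ≤ (31 * (k * (k + 1))) ^ (k - 1) := by
  induction k, hk using Nat.le_induction with
  | base => decide
  | succ k hk ih =>
    obtain ⟨j, rfl⟩ : ∃ j, k = j + 1 := ⟨k - 1, by omega⟩
    simp only [Nat.add_sub_cancel] at ih ⊢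
    -- This factor 2 turns 31 into 62 ≥ 40 in the ratio of consecutive right-hand sides.
    have h2 : 2 * (j + 1) ^ j ≤ (j + 3) ^ j := by
      obtain ⟨i, rfl⟩ : ∃ i, j = i + 1 := ⟨j - 1, by omega⟩
      have h := pow_add_mul_pow_le_add_pow (i + 1 + 1) 2 i
      refine le_trans ?_ h
      rw [two_mul]
      refine Nat.add_le_add_left ?_ _
      rw [pow_succ, mul_comm]
      gcongr
      omega
    calc 40 ^ (j + 1 + 1 + 1) * ((j + 1 + 1).factorial * (j + 1).factorial)
        = 40 * ((j + 2) * (j + 1)) * (40 ^ (j + 1 + 1) * ((j + 1).factorial * j.factorial)) := by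
          rw [Nat.factorial_succ (j + 1), Nat.factorial_succ j]; ring
      _ ≤ 62 * ((j + 2) * (j + 3)) * (31 * ((j + 1) * (j + 1 + 1))) ^ j := by
          gcongr <;> omega
      _ = 31 * ((j + 2) * (j + 3)) * (31 * (j + 2)) ^ j * (2 * (j + 1) ^ j) := by
          rw [mul_pow, mul_pow, mul_pow]; ring
      _ ≤ 31 * ((j + 2) * (j + 3)) * (31 * (j + 2)) ^ j * (j + 3) ^ j := by gcongr
      _ = _ := by rw [mul_assoc, ← mul_pow, pow_succ]; ring

theorem boundedCount_pairWeights_le {m : ℕ} (hm : 0 < m) {k M : ℕ} (hM : M ≤ (k + 1) ^ 2) :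
    boundedCount (pairWeights m) M ≤ 40 ^ (k + 1) := by
  -- With this K both exponents are linear in k + 1: M/K ≤ 2(k+1), and the two products together
  -- give (k+1)π²/6.
  set K : ℝ := ((k : ℝ) + 1) / 2 with hKdef
  have hK : 0 < K := by positivity
  set x : ℝ := K / (K + 1) with hx
  have hx0 : 0 < x := by positivity
  have hx1 : x < 1 := by rw [hx, div_lt_one (by positivity)]; linarith
  have h := boundedCount_le_mul_prod hx0 hx1 (pairWeights m)
    (fun w hw => by simp [pairWeights] at hw; omega) M
  have h1 := prod_range'_le hK m
  have hpos : ∀ l : List ℕ, (∀ w ∈ l, 0 < w) → 0 ≤ (l.map fun w => (1 - x ^ w)⁻¹).prod :=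
    fun l hl => le_trans (by positivity) (boundedCount_le_mul_prod hx0 hx1 l hl 0)
  have h2 : ((List.range' 2 (m - 1)).map fun w => (1 - x ^ w)⁻¹).prod ≤
      ((List.range' 1 m).map fun w => (1 - x ^ w)⁻¹).prod := by
    obtain ⟨m, rfl⟩ : ∃ j, m = j + 1 := ⟨m - 1, by omega⟩
    rw [List.range'_succ, List.map_cons, List.prod_cons, Nat.add_sub_cancel]
    refine le_mul_of_one_le_left (hpos _ fun w hw => by simp at hw; omega) ?_
    rw [one_le_inv₀ (by simpa using hx1)]
    simpa using hx0.le
  rw [pairWeights, List.map_append, List.prod_append] at h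
  have h3 : (boundedCount (pairWeights m) M : ℝ) * x ^ M ≤
      Real.exp (K * (Real.pi ^ 2 / 6)) * Real.exp (K * (Real.pi ^ 2 / 6)) :=
    h.trans (mul_le_mul h1 (h2.trans h1) (hpos _ fun w hw => by simp at hw; omega)
      (Real.exp_pos _).le)
  have hxinv : x⁻¹ ≤ Real.exp (1 / K) := by
    have : x⁻¹ = 1 / K + 1 := by rw [hx]; field_simp; ring
    rw [this]
    exact Real.add_one_le_exp _
  have hxM : (x ^ M)⁻¹ ≤ Real.exp (2 * ((k : ℝ) + 1)) := by
    have hM' : (M : ℝ) ≤ ((k : ℝ) + 1) ^ 2 := by exact_mod_cast hM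
    calc (x ^ M)⁻¹ = x⁻¹ ^ M := (inv_pow _ _).symm
      _ ≤ Real.exp (1 / K) ^ M := by gcongr
      _ = Real.exp (M * (1 / K)) := by rw [Real.exp_nat_mul]
      _ ≤ _ := by
        refine Real.exp_le_exp.2 ?_
        calc (M : ℝ) * (1 / K) ≤ ((k : ℝ) + 1) ^ 2 * (1 / K) := by gcongr
          _ = _ := by rw [hKdef]; field_simp
  have hfin : (boundedCount (pairWeights m) M : ℝ) ≤ 40 ^ (k + 1) := by
    calc (boundedCount (pairWeights m) M : ℝ)
        = boundedCount (pairWeights m) M * x ^ M * (x ^ M)⁻¹ := by field_simp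
      _ ≤ Real.exp (K * (Real.pi ^ 2 / 6)) * Real.exp (K * (Real.pi ^ 2 / 6)) *
          Real.exp (2 * ((k : ℝ) + 1)) := by gcongr
      _ = Real.exp (2 + Real.pi ^ 2 / 6) ^ (k + 1) := by
        rw [← Real.exp_nat_mul, ← Real.exp_add, ← Real.exp_add]
        congr 1
        push_cast
        rw [hKdef]
        ring
      _ ≤ _ := by gcongr; exact exp_growth_le
  exact_mod_cast hfin

/-! ### Parts congruent to ±2 and their weights -/

/-- The parts congruent to `±2` modulo `d + 3` other than `2` and `d + 1`, up to a bound. -/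
def largeParts (d m : ℕ) : List ℕ :=
  (List.range' 1 m).map (fun w => w * (d + 3) + 2) ++
    (List.range' 2 (m - 1)).map (fun w => w * (d + 3) - 2)

/-- Rounding that sends both w(d+3)+2 and w(d+3)-2 to w, and the part 2 to 0, once d ≥ 2. -/
def weight (d s : ℕ) : ℕ := (s + 2) / (d + 3)

theorem weight_add {d w : ℕ} (hd : 2 ≤ d) : weight d (w * (d + 3) + 2) = w := by
  rw [weight, Nat.div_eq_iff (by omega)]
  constructor <;> (have : (w + 1) * (d + 3) = w * (d + 3) + (d + 3) := by ring) <;> omega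

theorem weight_sub {d w : ℕ} (hw : 1 ≤ w) : weight d (w * (d + 3) - 2) = w := by
  have : 1 * (d + 3) ≤ w * (d + 3) := Nat.mul_le_mul_right _ hw
  rw [weight, Nat.sub_add_cancel (by omega), Nat.mul_div_cancel _ (by omega)]

theorem map_weight_largeParts {d : ℕ} (hd : 2 ≤ d) (m : ℕ) :
    (largeParts d m).map (weight d) = pairWeights m := by
  rw [largeParts, pairWeights, List.map_append, List.map_map, List.map_map]
  congr 1
  · exact (List.map_congr_left fun w _ => weight_add hd).trans (List.map_id _)
  · refine (List.map_congr_left fun w hw => weight_sub ?_).trans (List.map_id _)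
    simp at hw; omega

theorem nodup_largeParts {d : ℕ} (hd : 2 ≤ d) (m : ℕ) : (largeParts d m).Nodup := by
  rw [largeParts, List.nodup_append]
  refine ⟨?_, ?_, ?_⟩
  · refine List.Nodup.map_on (fun w _ v _ h => ?_) (List.nodup_range')
    simpa [weight_add hd] using congrArg (weight d) h
  · refine List.Nodup.map_on (fun w hw v hv h => ?_) (List.nodup_range')
    simp only [List.mem_range'_1] at hw hv
    have := congrArg (weight d) h
    rwa [weight_sub (by omega), weight_sub (by omega)] at this
  · intro s hs t ht hst
    simp only [List.mem_map, List.mem_range'_1] at hs ht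
    obtain ⟨w, hw, rfl⟩ := hs
    obtain ⟨v, hv, rfl⟩ := ht
    have := congrArg (weight d) hst
    rw [weight_add hd, weight_sub (by omega)] at this
    subst this
    omega

theorem eq_of_modEq_two {d x : ℕ} (hx : 0 < x)
    (h : ((x : ℤ) ≡ ((2 : ℕ) : ℤ) [ZMOD ((d : ℤ) + 3)] ∨
      (x : ℤ) ≡ -((2 : ℕ) : ℤ) [ZMOD ((d : ℤ) + 3)]) ∧
        (x : ℤ) ≠ (d : ℤ) + 3 - ((2 : ℕ) : ℤ)) :
    x = 2 ∨ (∃ w, 1 ≤ w ∧ x = w * (d + 3) + 2) ∨ ∃ w, 2 ≤ w ∧ x = w * (d + 3) - 2 := by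
  obtain ⟨h | h, hne⟩ := h
  · obtain ⟨c, hc⟩ := h.symm.dvd
    have hc0 : 0 ≤ c := by
      by_contra! hneg
      have : ((d : ℤ) + 3) * c ≤ ((d : ℤ) + 3) * (-1) := by gcongr; omega
      push_cast at hc
      omega
    lift c to ℕ using hc0
    have hx' : x = c * (d + 3) + 2 := by zify; push_cast at hc; linarith
    rcases Nat.eq_zero_or_pos c with rfl | hc'
    · left; simpa using hx'
    · exact Or.inr (Or.inl ⟨c, hc', hx'⟩)
  · obtain ⟨c, hc⟩ := h.symm.dvd
    have hc0 : 0 ≤ c := by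
      by_contra! hneg
      have : ((d : ℤ) + 3) * c ≤ ((d : ℤ) + 3) * (-1) := by gcongr; omega
      push_cast at hc
      omega
    lift c to ℕ using hc0
    have hx' : x + 2 = c * (d + 3) := by zify; push_cast at hc; linarith
    refine Or.inr (Or.inr ⟨c, ?_, by omega⟩)
    by_contra! hlt
    interval_cases c
    · omega
    · push_cast at hne; omega

/-- The finset counted by `partsModCountMinus d 2 n`. -/
def modPartitions (d n : ℕ) : Finset n.Partition :=
  Finset.univ.filter fun p : n.Partition =>
    ∀ x ∈ p.parts,
      ((x : ℤ) ≡ ((2 : ℕ) : ℤ) [ZMOD ((d : ℤ) + 3)] ∨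
        (x : ℤ) ≡ -((2 : ℕ) : ℤ) [ZMOD ((d : ℤ) + 3)]) ∧
        (x : ℤ) ≠ (d : ℤ) + 3 - ((2 : ℕ) : ℤ)

theorem mem_parts_of_mem_modPartitions {d n x : ℕ} {p : n.Partition} (hp : p ∈ modPartitions d n)
    (hx : x ∈ p.parts) :
    x = 2 ∨ (∃ w, 1 ≤ w ∧ x = w * (d + 3) + 2) ∨ ∃ w, 2 ≤ w ∧ x = w * (d + 3) - 2 :=
  eq_of_modEq_two (p.parts_pos hx) ((Finset.mem_filter.1 hp).2 x hx)

theorem partition_eq_of_count_eq {n : ℕ} {p p' : n.Partition}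
    (h : ∀ s, s ≠ 2 → p.parts.count s = p'.parts.count s) : p = p' := by
  have hf : p.parts.filter (· ≠ 2) = p'.parts.filter (· ≠ 2) := by
    ext s
    by_cases hs : s = 2
    · simp [hs]
    · rw [Multiset.count_filter_of_pos (p := fun x => x ≠ 2) hs,
        Multiset.count_filter_of_pos (p := fun x => x ≠ 2) hs, h s hs]
  have hsum : ∀ q : n.Partition,
      2 * q.parts.count 2 + (q.parts.filter (· ≠ 2)).sum = n := fun q => by
    have := congrArg Multiset.sum (Multiset.filter_add_not (· = 2) q.parts)
    rw [Multiset.sum_add, Multiset.filter_eq', Multiset.sum_replicate, q.parts_sum] at this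
    rwa [smul_eq_mul, mul_comm] at this
  have h1 := hsum p
  have h2 := hsum p'
  rw [hf] at h1
  ext s
  by_cases hs : s = 2
  · subst hs; omega
  · exact h s hs

theorem sub_two_bound {d w : ℕ} (hw : 2 ≤ w) : w * (d + 2) ≤ w * (d + 3) - 2 := by
  have : w * (d + 3) = w * (d + 2) + w := by ring
  omega

/-- The case w(d+3)-2 needs w ≥ 2, which is where the exclusion of d+1 enters. -/
theorem weight_mul_le {d n x : ℕ} (hd : 2 ≤ d) {p : n.Partition} (hp : p ∈ modPartitions d n)
    (hx : x ∈ p.parts) : weight d x * (d + 2) ≤ x := by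
  rcases mem_parts_of_mem_modPartitions hp hx with rfl | ⟨w, hw, rfl⟩ | ⟨w, hw, rfl⟩
  · rw [weight, Nat.div_eq_of_lt (by omega)]; omega
  · rw [weight_add hd]; nlinarith
  · rw [weight_sub (by omega)]; exact sub_two_bound hw

theorem part_le {n x : ℕ} {p : n.Partition} (hx : x ∈ p.parts) : x ≤ n :=
  (Multiset.le_sum_of_mem hx).trans_eq p.parts_sum

theorem mem_largeParts {d n m s : ℕ} (hd : 2 ≤ d) (hm : n / (d + 2) ≤ m) {p : n.Partition}
    (hp : p ∈ modPartitions d n) (hs : s ∈ p.parts) (h2 : s ≠ 2) : s ∈ largeParts d m := by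
  have hle : weight d s ≤ m := le_trans
    ((Nat.le_div_iff_mul_le (by omega)).2 ((weight_mul_le hd hp hs).trans (part_le hs))) hm
  rw [largeParts, List.mem_append, List.mem_map, List.mem_map]
  rcases mem_parts_of_mem_modPartitions hp hs with rfl | ⟨w, hw, rfl⟩ | ⟨w, hw, rfl⟩
  · exact absurd rfl h2
  · rw [weight_add hd] at hle
    exact Or.inl ⟨w, by simp; omega, rfl⟩
  · rw [weight_sub (by omega)] at hle
    exact Or.inr ⟨w, by simp; omega, rfl⟩

theorem partsModCountMinus_le {d n m : ℕ} (hd : 2 ≤ d) (hm : n / (d + 2) ≤ m) :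
    partsModCountMinus d 2 n ≤ boundedCount (pairWeights m) (n / (d + 2)) := by
  classical
  have h := card_le_boundedCount
    ((largeParts d m).map fun s => ((fun p : n.Partition => p.parts.count s), weight d s))
    (fun q hq => ?_) (modPartitions d n) (n / (d + 2)) ?_ ?_
  · rwa [List.map_map, show (Prod.snd ∘ fun s => ((fun p : n.Partition => p.parts.count s),
      weight d s)) = weight d from rfl, map_weight_largeParts hd] at h
  · obtain ⟨s, hs, rfl⟩ := List.mem_map.1 hq
    refine pos_of_mem_pairWeights (m := m) ?_
    rw [← map_weight_largeParts hd]
    exact List.mem_map_of_mem hs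
  · intro p hp
    rw [List.map_map, Nat.le_div_iff_mul_le (by omega)]
    have h1 : (p.parts.map fun s => weight d s * (d + 2)).sum ≤ n := by
      calc _ ≤ (p.parts.map fun s => s).sum :=
            Multiset.sum_map_le_sum_map _ _ fun s hs => weight_mul_le hd hp hs
        _ = n := by rw [Multiset.map_id', p.parts_sum]
    rw [Multiset.sum_map_mul_right] at h1
    refine le_trans (Nat.mul_le_mul_right _ ?_) h1
    rw [Finset.sum_multiset_map_count]
    rw [← List.sum_toFinset _ (nodup_largeParts hd m)]
    calc _ ≤ ∑ s ∈ (largeParts d m).toFinset ∩ p.parts.toFinset,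
          p.parts.count s • weight d s := by
          refine le_of_eq (Finset.sum_subset_zero_on_sdiff Finset.inter_subset_left
            (fun s hs => ?_) fun s _ => ?_).symm
          · have : s ∉ p.parts := fun hsp => by
              simp at hs
              exact hs.2 hsp
            simp [Multiset.count_eq_zero_of_notMem this]
          · simp [mul_comm]
      _ ≤ _ := Finset.sum_le_sum_of_subset Finset.inter_subset_right
  · intro p hp p' hp' h
    refine partition_eq_of_count_eq fun s hs => ?_
    by_cases hmem : s ∈ largeParts d m
    · exact h (_, weight d s) (List.mem_map.2 ⟨s, hmem, rfl⟩)
    · rw [Multiset.count_eq_zero_of_notMem fun h => hmem (mem_largeParts hd hm hp h hs),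
        Multiset.count_eq_zero_of_notMem fun h => hmem (mem_largeParts hd hm hp' h hs)]

/-! ### Comparison of the two counts -/

theorem partsGapCount_lower {d n k : ℕ} (hk : 1 ≤ k) (hkM : k ≤ n / (d + 2))
    (hc : k.choose 2 ≤ n / (d + 2)) :
    (d * (n / (d + 2) - k.choose 2)) ^ (k - 1) ≤
      partsGapCount d 2 n * (k.factorial * (k - 1).factorial) := by
  obtain ⟨j, rfl⟩ : ∃ j, k = j + 1 := ⟨k - 1, by omega⟩
  set M := n / (d + 2) with hM
  have hMn : M * (d + 2) ≤ n := Nat.div_mul_le_self _ _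
  obtain ⟨Y, hY⟩ := Nat.exists_eq_add_of_le hc
  have hX : (j + 1) * 2 + d * (j + 1).choose 2 + d * Y ≤ n := by
    calc _ = (j + 1) * 2 + d * M := by rw [hY]; ring
      -- Since k ≤ M, the 2k needed for the minimal parts fits into 2M.
      _ ≤ M * (d + 2) := by nlinarith
      _ ≤ n := hMn
  obtain ⟨Z, hZ⟩ := Nat.exists_eq_add_of_le hX
  have h1 := boundedCount_le_partsGapCount d 2 n j (d * Y + Z) (by omega) (by omega)
  have h2 := pow_length_le_boundedCount (descList j) (fun w hw => pos_of_mem_descList hw)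
    (d * Y + Z)
  rw [descList_length, descList_prod] at h2
  rw [hY, Nat.add_sub_cancel_left, Nat.add_sub_cancel]
  calc (d * Y) ^ j ≤ (d * Y + Z) ^ j := by gcongr; omega
    _ ≤ _ := h2
    _ ≤ _ := by rw [mul_comm j.factorial]; gcongr

theorem le_partsGapCount_of_bound {d n k m : ℕ} (hd : 62 ≤ d) (hk : 1 ≤ k)
    (hkM : k ≤ n / (d + 2)) (hc : k.choose 2 ≤ n / (d + 2)) (hm : n / (d + 2) ≤ m)
    (h : boundedCount (pairWeights m) (n / (d + 2)) * (k.factorial * (k - 1).factorial) ≤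
      (62 * (n / (d + 2) - k.choose 2)) ^ (k - 1)) :
    partsModCountMinus d 2 n ≤ partsGapCount d 2 n := by
  refine (partsModCountMinus_le (by omega) hm).trans ?_
  refine Nat.le_of_mul_le_mul_right (c := k.factorial * (k - 1).factorial) ?_ (by positivity)
  refine h.trans (le_trans ?_ (partsGapCount_lower hk hkM hc))
  gcongr

theorem two_mul_choose_two_add (k : ℕ) : 2 * k.choose 2 + k = k ^ 2 := by
  induction k with
  | zero => rfl
  | succ k ih =>
    rw [Nat.choose_succ_succ' k 1, Nat.choose_one_right]
    nlinarith

theorem le_partsGapCount_of_le {d n : ℕ} (hd : 62 ≤ d) (h2 : 2 ≤ n / (d + 2)) :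
    partsModCountMinus d 2 n ≤ partsGapCount d 2 n := by
  set M := n / (d + 2) with hM
  have hs := Nat.sqrt_le' M
  have hs' := Nat.lt_succ_sqrt' M
  rcases le_or_gt M 48 with h48 | h48
  · have hmax : 2 * (max 2 M.sqrt).choose 2 ≤ 2 * M ∧ max 2 M.sqrt ≤ M := by
      rcases le_total M.sqrt 2 with h | h
      · rw [max_eq_left h]; simp; omega
      · rw [max_eq_right h]
        have := two_mul_choose_two_add M.sqrt
        constructor
        · omega
        · nlinarith
    exact le_partsGapCount_of_bound hd (by omega) hmax.2 (by omega) h48 (boundedCount_small h2 h48)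
  · have hk : 7 ≤ M.sqrt := Nat.le_sqrt'.2 (by omega)
    set k := M.sqrt with hkdef
    have hck := two_mul_choose_two_add k
    refine le_partsGapCount_of_bound (k := k) hd (by omega) (by nlinarith) (by omega) le_rfl ?_
    calc _ ≤ 40 ^ (k + 1) * (k.factorial * (k - 1).factorial) := by
          gcongr
          exact boundedCount_pairWeights_le (by omega) hs'.le
      _ ≤ (31 * (k * (k + 1))) ^ (k - 1) := forty_pow_mul_factorial_le hk
      _ ≤ _ := by
        -- From M ≥ k² one gets M - C(k,2) ≥ k(k+1)/2.
        gcongr ?_ ^ _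
        have : k * (k + 1) = k ^ 2 + k := by ring
        rw [this]
        omega

theorem partsModCountMinus_le_two {d n : ℕ} (hd : 62 ≤ d) (h : n / (d + 2) ≤ 1) :
    partsModCountMinus d 2 n ≤ 2 := by
  refine (partsModCountMinus_le (m := 1) (by omega) h).trans ?_
  interval_cases n / (d + 2) <;> decide

theorem eq_two_of_mem_parts {d n x : ℕ} (hd : 0 < d) (h : n < d + 5) {p : n.Partition}
    (hp : p ∈ modPartitions d n) (hx : x ∈ p.parts) : x = 2 := by
  have hle := part_le hx
  rcases mem_parts_of_mem_modPartitions hp hx with h2 | ⟨w, hw, rfl⟩ | ⟨w, hw, rfl⟩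
  · exact h2
  · nlinarith
  · have : 2 * (d + 3) ≤ w * (d + 3) := Nat.mul_le_mul_right _ hw
    omega

theorem partsModCountMinus_le_one {d n : ℕ} (hd : 0 < d) (h : n < d + 5) : partsModCountMinus d 2 n ≤ 1 := by
  refine Finset.card_le_one.2 fun p hp p' hp' => partition_eq_of_count_eq fun s hs => ?_
  rw [Multiset.count_eq_zero_of_notMem fun hm => hs (eq_two_of_mem_parts hd h hp hm),
    Multiset.count_eq_zero_of_notMem fun hm => hs (eq_two_of_mem_parts hd h hp' hm)]

theorem partsModCountMinus_one {d : ℕ} (hd : 0 < d) : partsModCountMinus d 2 1 = 0 := by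
  refine Finset.card_eq_zero.2 (Finset.eq_empty_of_forall_notMem fun p hp => ?_)
  have hne : p.parts ≠ 0 := fun h => by
    have := p.parts_sum
    rw [h] at this
    simp at this
  obtain ⟨x, hx⟩ := Multiset.exists_mem_of_ne_zero hne
  have := part_le hx
  have := eq_two_of_mem_parts hd (by omega) hp hx
  omega

theorem mainTheorem1 (d n : ℕ) (hd : 62 ≤ d) (hn : 1 ≤ n) :
    0 ≤ deltaMinus d 2 2 n := by
  suffices h : partsModCountMinus d 2 n ≤ partsGapCount d 2 n by
    rw [deltaMinus, sub_nonneg]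
    exact_mod_cast h
  rcases le_or_gt 2 (n / (d + 2)) with h2 | h2
  · exact le_partsGapCount_of_le hd h2
  rcases lt_or_ge n (d + 5) with h5 | h5
  · rcases hn.eq_or_lt with rfl | hn
    · rw [partsModCountMinus_one (by omega)]; exact Nat.zero_le _
    · exact (partsModCountMinus_le_one (by omega) h5).trans
        (card_le_partsGapCount d 2 n (by omega) {[n]} (by simp; omega))
  -- From n ≥ d + 5 on, 2 and n - 2 are far enough apart to give a second gap partition.
  · refine (partsModCountMinus_le_two hd (by omega)).trans
      (le_trans ?_ (card_le_partsGapCount d 2 n (by omega) {[n], [2, n - 2]} ?_))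
    · rw [Finset.card_pair (by simp)]
    · simp; omega
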